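/- Let $G$ be a finite simple graph with maximum degree $\Delta$ that is of Class 2, i.e. its chromatic index is not equal to $\Delta$. Let $a,b,u,x,y$ be five distinct vertices of $G$ such that $ab$, $bu$, $ux$, $uy$ are edges of $G$, and let $\varphi$ be a $\Delta$-edge-coloring of $G-ab$, i.e. a map from the edges of $G-ab$ to $\{1,\dots,\Delta\}$ that gives different colors to any two adjacent edges. For a vertex $v$ let $\overline{\varphi}(v)$ be the set of colors in $\{1,\dots,\Delta\}$ that are not assigned to any edge of $G-ab$ incident with $v$. A Kierstead path with respect to an edge $e_1$ of $G$ and an edge-coloring $\varphi$ of $G-e_1$ is a sequence $(y_0,e_1,y_1,\dots,e_p,y_p)$ with $p\ge 1$, where $y_0,\dots,y_p$ are distinct vertices, $e_i=y_{i-1}y_i$ is an edge of $G$ for $1\le i\le p$, and for every $2\le i\le p$ there is a $j$ with $0\le j<i$ and $\varphi(e_i)\in\overline{\varphi}(y_j)$. If $(a,ab,b,bu,u,ux,x)$ and $(a,ab,b,bu,u,uy,y)$ are both Kierstead paths with respect to $ab$ and $\varphi$, then $$|\overline{\varphi}(x)\cap(\overline{\varphi}(a)\cup\overline{\varphi}(b))|+|\overline{\varphi}(y)\cap(\overline{\varphi}(a)\cup\overline{\varphi}(b))|\le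 1.$$ -/

import Mathlib

namespace SimpleGraph

variable {V : Type*}

/-- A `k`-edge-coloring of `G`: a map from the edges of `G` to `k` colors such that any two
distinct edges with a common end receive different colors. -/
abbrev EdgeColoring (G : SimpleGraph V) (k : ℕ) : Type _ :=
  G.lineGraph.Coloring (Fin k)

/-- The chromatic index of `G`: the least `k` such that `G` has a `k`-edge-coloring. -/
noncomputable def chromaticIndex (G : SimpleGraph V) : ℕ∞ :=
  G.lineGraph.chromaticNumber

/-- A finite graph is of Class 1 if its chromatic index equals its maximum degree, and of
Class 2 otherwise. -/
def IsClassTwo [Fintype V] (G : SimpleGraph V) [DecidableRel G.Adj] : Prop :=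
  G.chromaticIndex ≠ (G.maxDegree : ℕ∞)

namespace EdgeColoring

open Classical in
/-- The set of colors present at the vertex `v`. -/
noncomputable def present {G : SimpleGraph V} {k : ℕ} (φ : G.EdgeColoring k) (v : V) :
    Finset (Fin k) :=
  Finset.univ.filter fun c => ∃ e : G.edgeSet, v ∈ (e : Sym2 V) ∧ φ e = c

/-- The set of colors missing at the vertex `v`. -/
noncomputable def missing {G : SimpleGraph V} {k : ℕ} (φ : G.EdgeColoring k) (v : V) :
    Finset (Fin k) :=
  Finset.univ \ φ.present v

end EdgeColoring

/-- Let `φ` be a `k`-edge-coloring of `G - e`. The vertices `y 0, …, y (p + 1)` are those of a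
Kierstead path `(y 0, e₁, y 1, …, e_{p+1}, y (p + 1))` with respect to `e` and `φ`, where the
`i`-th edge, counted from `0`, joins `y i` and `y (i + 1)`. The length `p + 1` is at least `1`. -/
structure IsKiersteadPath (G : SimpleGraph V) {k : ℕ} (e : Sym2 V)
    (φ : (G.deleteEdges {e}).EdgeColoring k) {p : ℕ} (y : Fin (p + 2) → V) : Prop where
  /-- The vertices are distinct. -/
  injective : Function.Injective y
  /-- Consecutive vertices are joined by an edge of `G`. -/
  adj : ∀ i : Fin (p + 1), G.Adj (y i.castSucc) (y i.succ)
  /-- The first edge is `e`. -/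
  first : s(y 0, y 1) = e
  /-- The color of each edge other than the first is missing at one of the vertices that precede
  the end of this edge. -/
  color : ∀ i : Fin (p + 1), i ≠ 0 →
    ∃ h : s(y i.castSucc, y i.succ) ∈ (G.deleteEdges {e}).edgeSet,
      ∃ j : Fin (p + 2), j < i.succ ∧ φ ⟨s(y i.castSucc, y i.succ), h⟩ ∈ φ.missing (y j)

end SimpleGraph

/-! Let `A` and `B` be the sets of colors missing at `a` and `b`, and `o ∈ A` the color of `bu`.
Since the chromatic index is at least `Δ`, Class 2 means that no `Δ`-edge-coloring of `G` exists.
Hence `A` and `B` are disjoint, and for `α ∈ A`, `β ∈ B` the Kempe chain of `a` contains `b`;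
otherwise a swap on it frees `β` for `ab`. A chain has at most two ends, so swapping at a third end,
such as `x` or `y` when it misses `α` or `β`, disturbs neither `a` nor `b`
(`IsKempeConfig.exists_swap`). These swaps are used to normalize the colors of `ux` and `uy` and the
colors missing at `x` and `y`.

Two normal forms are contradictory. In `not_isLeg_base_color` a path is recolored at once. In
`false_of_legs` the edges `ab`, `bu`, `ux`, `uy` are all erased, and the rest is handled by chains
in the remaining graph, where swaps may also affect `a` and `b`.

The set `B` is nonempty. If it has two colors, both intersections are empty (`not_isLeg_of_ne`). If
`B = {β}`, each has at most one element (`leg_missing_unique`), and they are not both nonempty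
(`false_of_two_legs`). -/

namespace SimpleGraph

/-! ### Kempe chains and swaps -/

section Kempe

variable {V C : Type*}

/-- The map `c` gives different colors to adjacent edges of `H`. -/
def IsProperOn (H : SimpleGraph V) (c : Sym2 V → C) : Prop :=
  ∀ ⦃v w w' : V⦄, H.Adj v w → H.Adj v w' → c s(v, w) = c s(v, w') → w = w'

/-- No edge of `H` at the vertex `v` has color `γ`. -/
def Avoids (H : SimpleGraph V) (c : Sym2 V → C) (v : V) (γ : C) : Prop :=
  ∀ w, H.Adj v w → c s(v, w) ≠ γ

theorem IsProperOn.mono {H H' : SimpleGraph V} {c : Sym2 V → C} (hc : H.IsProperOn c)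
    (h : H' ≤ H) : H'.IsProperOn c :=
  fun _ _ _ h₁ h₂ => hc (h h₁) (h h₂)

theorem Avoids.mono {H H' : SimpleGraph V} {c : Sym2 V → C} {v : V} {γ : C}
    (hv : H.Avoids c v γ) (h : H' ≤ H) : H'.Avoids c v γ :=
  fun w hw => hv w (h hw)

/-- The graph formed by the edges of `H` of color `α` or `β`. -/
def kempeGraph (H : SimpleGraph V) (c : Sym2 V → C) (α β : C) : SimpleGraph V where
  Adj v w := H.Adj v w ∧ (c s(v, w) = α ∨ c s(v, w) = β)
  symm := ⟨fun v w h => by rw [Sym2.eq_swap]; exact ⟨h.1.symm, h.2⟩⟩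
  loopless := ⟨fun _ h => h.1.ne rfl⟩

/-- A set of vertices that is not left by the edges of color `α` or `β`. -/
def IsKempeClosed (H : SimpleGraph V) (c : Sym2 V → C) (α β : C) (S : Set V) : Prop :=
  ∀ ⦃v w : V⦄, H.Adj v w → c s(v, w) = α ∨ c s(v, w) = β → (v ∈ S ↔ w ∈ S)

theorem IsKempeClosed.compl {H : SimpleGraph V} {c : Sym2 V → C} {α β : C} {S : Set V}
    (hS : H.IsKempeClosed c α β S) : H.IsKempeClosed c α β Sᶜ :=
  fun _ _ h hc => not_congr (hS h hc)

theorem IsKempeClosed.union {H : SimpleGraph V} {c : Sym2 V → C} {α β : C} {S T : Set V}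
    (hS : H.IsKempeClosed c α β S) (hT : H.IsKempeClosed c α β T) :
    H.IsKempeClosed c α β (S ∪ T) :=
  fun _ _ h hc => or_congr (hS h hc) (hT h hc)

/-- The vertex set of the Kempe chain with colors `α` and `β` through `p`. -/
def kempeChain (H : SimpleGraph V) (c : Sym2 V → C) (α β : C) (p : V) : Set V :=
  {v | (H.kempeGraph c α β).Reachable p v}

theorem mem_kempeChain_self (H : SimpleGraph V) (c : Sym2 V → C) (α β : C) (p : V) :
    p ∈ H.kempeChain c α β p :=
  Reachable.refl p

theorem isKempeClosed_kempeChain (H : SimpleGraph V) (c : Sym2 V → C) (α β : C) (p : V) :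
    H.IsKempeClosed c α β (H.kempeChain c α β p) := by
  intro v w h hc
  have hvw : (H.kempeGraph c α β).Adj v w := ⟨h, hc⟩
  exact ⟨fun hv => hv.trans hvw.reachable, fun hw => hw.trans hvw.symm.reachable⟩

/-- A connected component of a graph of maximum degree at most `2` has at most two vertices of
degree at most `1`. -/
theorem not_reachable_three_ends [Finite V] {K : SimpleGraph V}
    (hK : ∀ v, (K.neighborSet v).ncard ≤ 2) {p q r : V} (hpq : p ≠ q) (hpr : p ≠ r) (hqr : q ≠ r)
    (hp : (K.neighborSet p).ncard ≤ 1) (hq : (K.neighborSet q).ncard ≤ 1)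
    (hr : (K.neighborSet r).ncard ≤ 1) (h₁ : K.Reachable p q) (h₂ : K.Reachable p r) : False := by
  classical
  have := Fintype.ofFinite V
  set S : Set V := (K.connectedComponentMk p).supp with hS
  have hconn : (K.induce S).Connected := ConnectedComponent.connected_toSimpleGraph _
  have hcard := hconn.card_vert_le_card_edgeSet_add_one
  rw [Nat.card_eq_fintype_card, Nat.card_eq_fintype_card, ← edgeFinset_card] at hcard
  have hsum := (K.induce S).sum_degrees_eq_twice_card_edges
  have hdeg : ∀ v : S, (K.induce S).degree v ≤ (K.neighborSet v).ncard := by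
    intro v
    rw [← card_neighborSet_eq_degree, ← Nat.card_eq_fintype_card, Nat.card_coe_set_eq]
    refine Set.ncard_le_ncard_of_injOn Subtype.val (fun w hw => ?_)
      Subtype.val_injective.injOn (Set.toFinite _)
    simpa using hw
  have hpS : p ∈ S := rfl
  have hqS : q ∈ S := (ConnectedComponent.eq.2 h₁).symm
  have hrS : r ∈ S := (ConnectedComponent.eq.2 h₂).symm
  let T : Finset S := {⟨p, hpS⟩, ⟨q, hqS⟩, ⟨r, hrS⟩}
  have hT : T.card = 3 := Finset.card_eq_three.2
    ⟨_, _, _, by simpa using hpq, by simpa using hpr, by simpa using hqr, rfl⟩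
  -- A component on `n` vertices has at least `n - 1` edges, so degree sum at least `2n - 2`; three
  -- vertices of degree at most `1` would force at most `2n - 3`.
  have hle : ∑ v : S, ((K.induce S).degree v + if v ∈ T then 1 else 0) ≤ ∑ _v : S, 2 := by
    refine Finset.sum_le_sum fun v _ => ?_
    have h := hdeg v
    split_ifs with hv
    · have : (K.neighborSet v).ncard ≤ 1 := by
        simp only [T, Finset.mem_insert, Finset.mem_singleton] at hv
        rcases hv with rfl | rfl | rfl <;> assumption
      omega
    · have := hK v
      omega
  rw [Finset.sum_add_distrib, hsum] at hle
  simp only [Finset.sum_ite_mem, Finset.univ_inter, Finset.sum_const, hT, Finset.card_univ,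
    smul_eq_mul] at hle
  omega

theorem IsProperOn.ncard_neighborSet_kempeGraph_le_two {H : SimpleGraph V} {c : Sym2 V → C}
    (hc : H.IsProperOn c) (α β : C) (v : V) : ((H.kempeGraph c α β).neighborSet v).ncard ≤ 2 := by
  refine (Set.ncard_le_ncard_of_injOn (t := {α, β}) (fun w => c s(v, w)) (fun w hw => hw.2)
    (fun w hw w' hw' h => hc hw.1 hw'.1 h) (Set.toFinite _)).trans ?_
  simpa using Set.ncard_insert_le α {β}

/-- A vertex is an end of its Kempe chain if one of the two colors is missing there. -/
def IsKempeEnd (H : SimpleGraph V) (c : Sym2 V → C) (α β : C) (v : V) : Prop :=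
  H.Avoids c v α ∨ H.Avoids c v β

theorem IsProperOn.ncard_neighborSet_kempeGraph_le_one {H : SimpleGraph V} {c : Sym2 V → C}
    (hc : H.IsProperOn c) {α β : C} {v : V} (hv : H.IsKempeEnd c α β v) :
    ((H.kempeGraph c α β).neighborSet v).ncard ≤ 1 := by
  obtain ⟨γ, hγ⟩ : ∃ γ, ∀ w ∈ (H.kempeGraph c α β).neighborSet v, c s(v, w) = γ := by
    rcases hv with hv | hv
    · exact ⟨β, fun w hw => hw.2.resolve_left (hv w hw.1)⟩
    · exact ⟨α, fun w hw => hw.2.resolve_right (hv w hw.1)⟩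
  refine (Set.ncard_le_ncard_of_injOn (t := {γ}) (fun w => c s(v, w)) hγ
    (fun w hw w' hw' h => hc hw.1 hw'.1 h) (Set.toFinite _)).trans (Set.ncard_singleton γ).le

/-- A Kempe chain has at most two ends. -/
theorem IsProperOn.kempeChain_ends [Finite V] {H : SimpleGraph V} {c : Sym2 V → C}
    (hc : H.IsProperOn c) {α β : C} {p q r : V} (hpq : p ≠ q) (hpr : p ≠ r) (hqr : q ≠ r)
    (hp : H.IsKempeEnd c α β p) (hq : H.IsKempeEnd c α β q) (hr : H.IsKempeEnd c α β r)
    (hqp : q ∈ H.kempeChain c α β p) : r ∉ H.kempeChain c α β p := fun hrp =>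
  not_reachable_three_ends (hc.ncard_neighborSet_kempeGraph_le_two α β) hpq hpr hqr
    (hc.ncard_neighborSet_kempeGraph_le_one hp) (hc.ncard_neighborSet_kempeGraph_le_one hq)
    (hc.ncard_neighborSet_kempeGraph_le_one hr) hqp hrp

theorem mem_kempeChain_comm {H : SimpleGraph V} {c : Sym2 V → C} {α β : C} {p q : V} :
    q ∈ H.kempeChain c α β p ↔ p ∈ H.kempeChain c α β q :=
  ⟨Reachable.symm, Reachable.symm⟩

/-- Four ends of Kempe chains can be grouped into two pairs that are separated by a closed set. -/
theorem IsProperOn.exists_isKempeClosed_pair [Finite V] {H : SimpleGraph V} {c : Sym2 V → C}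
    (hc : H.IsProperOn c) {α β : C} {p q r s : V} (hpq : p ≠ q) (hpr : p ≠ r) (hps : p ≠ s)
    (hqr : q ≠ r) (hqs : q ≠ s) (hrs : r ≠ s)
    (hp : H.IsKempeEnd c α β p) (hq : H.IsKempeEnd c α β q) (hr : H.IsKempeEnd c α β r)
    (hs : H.IsKempeEnd c α β s) :
    ∃ S, H.IsKempeClosed c α β S ∧ p ∈ S ∧
      (q ∈ S ∧ r ∉ S ∧ s ∉ S ∨ q ∉ S ∧ r ∈ S ∧ s ∉ S ∨ q ∉ S ∧ r ∉ S ∧ s ∈ S) := by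
  have cl := H.isKempeClosed_kempeChain c α β
  have self := H.mem_kempeChain_self c α β
  by_cases h₁ : q ∈ H.kempeChain c α β p
  · exact ⟨_, cl p, self p, .inl ⟨h₁, hc.kempeChain_ends hpq hpr hqr hp hq hr h₁,
      hc.kempeChain_ends hpq hps hqs hp hq hs h₁⟩⟩
  by_cases h₂ : r ∈ H.kempeChain c α β p
  · exact ⟨_, cl p, self p, .inr <| .inl ⟨h₁, h₂, hc.kempeChain_ends hpr hps hrs hp hr hs h₂⟩⟩
  by_cases h₃ : s ∈ H.kempeChain c α β p
  · exact ⟨_, cl p, self p, .inr <| .inr ⟨h₁, h₂, h₃⟩⟩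
  -- The chain of `p` contains none of the others, so it is joined with the chain of one of them
  -- that avoids the other two.
  by_cases h₄ : r ∈ H.kempeChain c α β q
  · have h₅ : s ∉ H.kempeChain c α β q := hc.kempeChain_ends hqr hqs hrs hq hr hs h₄
    have h₆ : r ∉ H.kempeChain c α β s := fun h => hc.kempeChain_ends hqr.symm hrs hqs hr hq hs
      (mem_kempeChain_comm.1 h₄) (mem_kempeChain_comm.1 h)
    refine ⟨_, (cl p).union (cl s), .inl (self p), .inr <| .inr ⟨?_, ?_, .inr (self s)⟩⟩
    · rintro (h | h)
      exacts [h₁ h, h₅ (mem_kempeChain_comm.1 h)]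
    · rintro (h | h)
      exacts [h₂ h, h₆ h]
  by_cases h₅ : s ∈ H.kempeChain c α β q
  · have h₆ : s ∉ H.kempeChain c α β r := fun h => hc.kempeChain_ends hqs.symm hrs.symm hqr hs hq hr
      (mem_kempeChain_comm.1 h₅) (mem_kempeChain_comm.1 h)
    refine ⟨_, (cl p).union (cl r), .inl (self p), .inr <| .inl ⟨?_, .inr (self r), ?_⟩⟩
    · rintro (h | h)
      exacts [h₁ h, h₄ (mem_kempeChain_comm.1 h)]
    · rintro (h | h)
      exacts [h₃ h, h₆ h]
  · refine ⟨_, (cl p).union (cl q), .inl (self p), .inl ⟨.inr (self q), ?_, ?_⟩⟩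
    · rintro (h | h)
      exacts [h₂ h, h₄ h]
    · rintro (h | h)
      exacts [h₃ h, h₅ h]

/-- Permuting the colors at each vertex, consistently along the edges, gives a proper coloring. -/
theorem IsProperOn.exists_permute {H : SimpleGraph V} {c : Sym2 V → C} (hc : H.IsProperOn c)
    (π : V → Equiv.Perm C) (hπ : ∀ v w, H.Adj v w → π v (c s(v, w)) = π w (c s(v, w))) :
    ∃ c' : Sym2 V → C, H.IsProperOn c' ∧ (∀ v w, H.Adj v w → c' s(v, w) = π v (c s(v, w))) ∧
      ∀ v γ, H.Avoids c v γ → H.Avoids c' v (π v γ) := by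
  have key : ∀ v w, H.Adj v w → π (Quot.out s(v, w)).1 (c s(v, w)) = π v (c s(v, w)) := by
    intro v w h
    have := Sym2.out_fst_mem s(v, w)
    rw [Sym2.mem_iff] at this
    rcases this with h' | h' <;> rw [h']
    exact (hπ v w h).symm
  -- The new color is read at an arbitrary end of the edge; by `hπ` both ends agree.
  refine ⟨fun e => π (Quot.out e).1 (c e), fun v w w' h h' e => hc h h' ?_, key, ?_⟩
  · simpa only [key v w h, key v w' h', (π v).apply_eq_iff_eq] using e
  · intro v γ hγ w h e
    exact hγ w h ((π v).injective ((key v w h).symm.trans e))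

/-- Coloring one more edge. -/
theorem IsProperOn.exists_insert {H H' : SimpleGraph V} {c : Sym2 V → C} (hc : H.IsProperOn c)
    {p q : V} (hH : ∀ v w, H'.Adj v w → H.Adj v w ∨ s(v, w) = s(p, q)) {γ : C}
    (hp : H.Avoids c p γ) (hq : H.Avoids c q γ) :
    ∃ c' : Sym2 V → C, H'.IsProperOn c' ∧
      ∀ v δ, H.Avoids c v δ → (v = p ∨ v = q → δ ≠ γ) → H'.Avoids c' v δ := by
  classical
  have hmem : ∀ v w, s(v, w) = s(p, q) → H.Avoids c v γ := by
    intro v w h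
    have : v ∈ s(p, q) := h ▸ Sym2.mem_mk_left v w
    rcases Sym2.mem_iff.1 this with rfl | rfl <;> assumption
  refine ⟨Function.update c s(p, q) γ, ?_, ?_⟩
  · intro v w w' h h' e
    by_cases h₁ : s(v, w) = s(p, q) <;> by_cases h₂ : s(v, w') = s(p, q)
    · exact Sym2.congr_right.1 (h₁.trans h₂.symm)
    · rw [h₁, Function.update_self, Function.update_of_ne h₂] at e
      exact absurd e.symm (hmem v w h₁ w' ((hH v w' h').resolve_right h₂))
    · rw [h₂, Function.update_self, Function.update_of_ne h₁] at e
      exact absurd e (hmem v w' h₂ w ((hH v w h).resolve_right h₁))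
    · rw [Function.update_of_ne h₁, Function.update_of_ne h₂] at e
      exact hc ((hH v w h).resolve_right h₁) ((hH v w' h').resolve_right h₂) e
  · intro v δ hv hne w h
    by_cases h₁ : s(v, w) = s(p, q)
    · rw [h₁, Function.update_self]
      have : v ∈ s(p, q) := h₁ ▸ Sym2.mem_mk_left v w
      exact (hne (Sym2.mem_iff.1 this)).symm
    · rw [Function.update_of_ne h₁]
      exact hv w ((hH v w h).resolve_right h₁)

variable [DecidableEq C]

open Classical in
/-- The color that `γ` becomes at `v` when `α` and `β` are interchanged on the set `S`. -/
noncomputable def kempeSwap (α β : C) (S : Set V) (v : V) (γ : C) : C :=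
  if v ∈ S then Equiv.swap α β γ else γ

/-- Interchanging two colors on a closed set. -/
theorem IsProperOn.exists_kempeSwap {H : SimpleGraph V} {c : Sym2 V → C} (hc : H.IsProperOn c)
    {α β : C} {S : Set V} (hS : H.IsKempeClosed c α β S) :
    ∃ c' : Sym2 V → C, H.IsProperOn c' ∧
      (∀ v w, H.Adj v w → c' s(v, w) = kempeSwap α β S v (c s(v, w))) ∧
      ∀ v γ, H.Avoids c v γ → H.Avoids c' v (kempeSwap α β S v γ) := by
  classical
  have hπ : ∀ v γ, (if v ∈ S then Equiv.swap α β else 1 : Equiv.Perm C) γ = kempeSwap α β S v γ := by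
    intro v γ
    unfold kempeSwap
    split_ifs <;> rfl
  have := hc.exists_permute (fun v => if v ∈ S then Equiv.swap α β else 1) ?_
  · simpa only [hπ] using this
  intro v w h
  by_cases hm : c s(v, w) = α ∨ c s(v, w) = β
  · simp only [hS h hm]
  · rw [not_or] at hm
    simp only [hπ, kempeSwap, Equiv.swap_apply_of_ne_of_ne hm.1 hm.2, ite_self]

/-- A set closed for two colors stays closed when two other colors are interchanged. -/
theorem IsKempeClosed.of_kempeSwap {H : SimpleGraph V} {c c' : Sym2 V → C} {α β γ δ : C}
    {S T : Set V} (hT : H.IsKempeClosed c γ δ T) (hαγ : α ≠ γ) (hαδ : α ≠ δ) (hβγ : β ≠ γ)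
    (hβδ : β ≠ δ) (hc' : ∀ v w, H.Adj v w → c' s(v, w) = kempeSwap α β S v (c s(v, w))) :
    H.IsKempeClosed c' γ δ T := by
  intro v w h hm
  refine hT h ?_
  rw [hc' v w h, kempeSwap] at hm
  split_ifs at hm with hv
  · rw [Equiv.swap_apply_def] at hm
    grind
  · exact hm

end Kempe

/-! ### Coloring erased paths and forks -/

section Extension

variable {V C : Type*} {G R : SimpleGraph V} {c : Sym2 V → C} {a b u x y : V}

theorem sup_edge_adj_iff {s t v w : V} :
    (R ⊔ edge s t).Adj v w ↔ R.Adj v w ∨ s(v, w) = s(s, t) ∧ v ≠ w := by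
  rw [sup_adj, edge_adj, Sym2.eq_iff]

/-- Coloring the edges of a path with three edges. -/
theorem IsProperOn.exists_of_path (hc : R.IsProperOn c) (hd : [a, b, u, x].Nodup)
    (hR : ∀ v w, G.Adj v w → R.Adj v w ∨ s(v, w) = s(a, b) ∨ s(v, w) = s(b, u) ∨ s(v, w) = s(u, x))
    {p q r : C} (hpq : p ≠ q) (hqr : q ≠ r)
    (hap : R.Avoids c a p) (hbp : R.Avoids c b p) (hbq : R.Avoids c b q) (huq : R.Avoids c u q)
    (hur : R.Avoids c u r) (hxr : R.Avoids c x r) : ∃ c' : Sym2 V → C, G.IsProperOn c' := by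
  simp only [List.nodup_cons, List.mem_cons, List.not_mem_nil, or_false, not_or] at hd
  -- `p = r` is allowed, because `ab` and `ux` share no end.
  obtain ⟨c₁, hc₁, h₁⟩ := hc.exists_insert (H' := R ⊔ edge u x)
    (fun v w h => (sup_edge_adj_iff.1 h).imp_right And.left) hur hxr
  obtain ⟨c₂, hc₂, h₂⟩ := hc₁.exists_insert (H' := R ⊔ edge u x ⊔ edge b u)
    (fun v w h => (sup_edge_adj_iff.1 h).imp_right And.left)
    (h₁ b q hbq (by grind)) (h₁ u q huq (by grind))
  have hG : ∀ v w, G.Adj v w → (R ⊔ edge u x ⊔ edge b u).Adj v w ∨ s(v, w) = s(a, b) := by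
    intro v w h
    rw [sup_edge_adj_iff, sup_edge_adj_iff]
    rcases hR v w h with h' | h' | h' | h'
    exacts [.inl (.inl (.inl h')), .inr h', .inl (.inr ⟨h', h.ne⟩), .inl (.inl (.inr ⟨h', h.ne⟩))]
  obtain ⟨c₃, hc₃, -⟩ := hc₂.exists_insert hG
    (h₂ a p (h₁ a p hap (by grind)) (by grind)) (h₂ b p (h₁ b p hbp (by grind)) (by grind))
  exact ⟨c₃, hc₃⟩

/-- Coloring the edges of a path with two edges and of two more edges at its end. -/
theorem IsProperOn.exists_of_fork (hc : R.IsProperOn c) (hd : [a, b, u, x, y].Nodup)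
    (hR : ∀ v w, G.Adj v w → R.Adj v w ∨ s(v, w) = s(a, b) ∨ s(v, w) = s(b, u) ∨
      s(v, w) = s(u, x) ∨ s(v, w) = s(u, y))
    {p q r s : C} (hpq : p ≠ q) (hqr : q ≠ r) (hqs : q ≠ s) (hrs : r ≠ s)
    (hap : R.Avoids c a p) (hbp : R.Avoids c b p) (hbq : R.Avoids c b q) (huq : R.Avoids c u q)
    (hur : R.Avoids c u r) (hxr : R.Avoids c x r) (hus : R.Avoids c u s) (hys : R.Avoids c y s) :
    ∃ c' : Sym2 V → C, G.IsProperOn c' := by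
  simp only [List.nodup_cons, List.mem_cons, List.not_mem_nil, or_false, not_or] at hd
  obtain ⟨c₁, hc₁, h₁⟩ := hc.exists_insert (H' := R ⊔ edge u y)
    (fun v w h => (sup_edge_adj_iff.1 h).imp_right And.left) hus hys
  have hG : ∀ v w, G.Adj v w → (R ⊔ edge u y).Adj v w ∨ s(v, w) = s(a, b) ∨ s(v, w) = s(b, u) ∨
      s(v, w) = s(u, x) := by
    intro v w h
    rw [sup_edge_adj_iff]
    rcases hR v w h with h' | h' | h' | h' | h'
    exacts [.inl (.inl h'), .inr (.inl h'), .inr (.inr (.inl h')), .inr (.inr (.inr h')),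
      .inl (.inr ⟨h', h.ne⟩)]
  refine hc₁.exists_of_path ?_ hG hpq hqr (h₁ a p hap ?_) (h₁ b p hbp ?_) (h₁ b q hbq ?_)
    (h₁ u q huq ?_) (h₁ u r hur ?_) (h₁ x r hxr ?_)
  · simp only [List.nodup_cons, List.mem_cons, List.not_mem_nil, or_false, not_or]
    tauto
  all_goals grind

end Extension

/-! ### Erased forks that can be colored after Kempe swaps -/

section Fork

variable {V C : Type*} [Finite V] [DecidableEq C] {G R : SimpleGraph V} {c : Sym2 V → C}
  {a b u x y : V}

/-- A fork can be colored if the colors `o`, `σ`, `τ` are missing at `a` and `u`, the colors `o`,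
`β` at `b`, the colors `σ`, `β` at `x`, and the colors `τ`, `o` at `y`. -/
theorem IsProperOn.exists_of_fork_of_missing_ne (hc : R.IsProperOn c) (hd : [a, b, u, x, y].Nodup)
    (hR : ∀ v w, G.Adj v w → R.Adj v w ∨ s(v, w) = s(a, b) ∨ s(v, w) = s(b, u) ∨
      s(v, w) = s(u, x) ∨ s(v, w) = s(u, y))
    {o β σ τ : C} (hcol : [o, β, σ, τ].Nodup)
    (hao : R.Avoids c a o) (haσ : R.Avoids c a σ) (haτ : R.Avoids c a τ)
    (hbo : R.Avoids c b o) (hbβ : R.Avoids c b β)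
    (huo : R.Avoids c u o) (huσ : R.Avoids c u σ) (huτ : R.Avoids c u τ)
    (hxσ : R.Avoids c x σ) (hxβ : R.Avoids c x β) (hyτ : R.Avoids c y τ) (hyo : R.Avoids c y o) :
    ∃ c' : Sym2 V → C, G.IsProperOn c' := by
  have hd' := hd
  simp only [List.nodup_cons, List.mem_cons, List.not_mem_nil, or_false, not_or] at hd' hcol
  obtain ⟨⟨hoβ, hoσ, hoτ⟩, ⟨hβσ, hβτ⟩, hστ, -⟩ := hcol
  obtain ⟨⟨hab, hau, hax, hay⟩, ⟨hbu, hbx, hby⟩, ⟨hux, huy⟩, hxy, -⟩ := hd'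
  -- If the chain of `u` avoids `b`, a swap on it makes `β` available for `bu`. Otherwise `u` and
  -- `b` are its two ends, and a swap outside it makes `β` missing at `a` and `y`, and `τ` at `x`.
  have hS := R.isKempeClosed_kempeChain c τ β u
  have huS := R.mem_kempeChain_self c τ β u
  by_cases hbS : b ∈ R.kempeChain c τ β u
  · have end_u : R.IsKempeEnd c τ β u := .inl huτ
    have end_b : R.IsKempeEnd c τ β b := .inr hbβ
    have haS := hc.kempeChain_ends (Ne.symm hbu) (Ne.symm hau) (Ne.symm hab) end_u end_b
      (.inl haτ) hbS
    have hxS := hc.kempeChain_ends (Ne.symm hbu) hux hbx end_u end_b (.inr hxβ) hbS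
    have hyS := hc.kempeChain_ends (Ne.symm hbu) huy hby end_u end_b (.inl hyτ) hbS
    obtain ⟨c₁, hc₁, -, h₁⟩ := hc.exists_kempeSwap hS.compl
    generalize R.kempeChain c τ β u = S at *
    have haβ₁ : R.Avoids c₁ a β := by grind [kempeSwap]
    have hao₁ : R.Avoids c₁ a o := by grind [kempeSwap]
    have haσ₁ : R.Avoids c₁ a σ := by grind [kempeSwap]
    have hbo₁ : R.Avoids c₁ b o := by grind [kempeSwap]
    have hbβ₁ : R.Avoids c₁ b β := by grind [kempeSwap]
    have huo₁ : R.Avoids c₁ u o := by grind [kempeSwap]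
    have huσ₁ : R.Avoids c₁ u σ := by grind [kempeSwap]
    have huτ₁ : R.Avoids c₁ u τ := by grind [kempeSwap]
    have hxτ₁ : R.Avoids c₁ x τ := by grind [kempeSwap]
    have hyβ₁ : R.Avoids c₁ y β := by grind [kempeSwap]
    have hyo₁ : R.Avoids c₁ y o := by grind [kempeSwap]
    clear h₁ hS
    -- Now `β`, `o`, `τ` suit `ab`, `bu`, `ux`; it remains to free `σ` at `y`, or else `β` at `u`.
    have hS := R.isKempeClosed_kempeChain c₁ σ β u
    have huS := R.mem_kempeChain_self c₁ σ β u
    by_cases hbS : b ∈ R.kempeChain c₁ σ β u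
    · have hyS := hc₁.kempeChain_ends (Ne.symm hbu) huy hby (.inl huσ₁) (.inr hbβ₁) (.inr hyβ₁) hbS
      obtain ⟨c₂, hc₂, -, h₂⟩ := hc₁.exists_kempeSwap hS.compl
      generalize R.kempeChain c₁ σ β u = S at *
      refine hc₂.exists_of_fork hd hR (p := β) (q := o) (r := τ) (s := σ)
        ?_ ?_ ?_ ?_ ?_ ?_ ?_ ?_ ?_ ?_ ?_ ?_
      all_goals grind [kempeSwap]
    · obtain ⟨c₂, hc₂, -, h₂⟩ := hc₁.exists_kempeSwap hS
      generalize R.kempeChain c₁ σ β u = S at *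
      refine hc₂.exists_of_fork hd hR (p := o) (q := β) (r := τ) (s := o)
        ?_ ?_ ?_ ?_ ?_ ?_ ?_ ?_ ?_ ?_ ?_ ?_
      all_goals grind [kempeSwap]
  · obtain ⟨c₁, hc₁, -, h₁⟩ := hc.exists_kempeSwap hS
    generalize R.kempeChain c τ β u = S at *
    refine hc₁.exists_of_fork hd hR (p := o) (q := β) (r := σ) (s := o)
      ?_ ?_ ?_ ?_ ?_ ?_ ?_ ?_ ?_ ?_ ?_ ?_
    all_goals grind [kempeSwap]

/-- A fork can be colored if the colors `o`, `β`, `τ` are missing at `a`, the colors `o`, `τ` at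
`b`, the colors `o`, `σ`, `τ` at `u`, and the colors `o`, `β` at `x` and `y`. -/
theorem IsProperOn.exists_of_fork_of_missing_pair (hc : R.IsProperOn c)
    (hd : [a, b, u, x, y].Nodup)
    (hR : ∀ v w, G.Adj v w → R.Adj v w ∨ s(v, w) = s(a, b) ∨ s(v, w) = s(b, u) ∨
      s(v, w) = s(u, x) ∨ s(v, w) = s(u, y))
    {o β σ τ : C} (hcol : [o, β, σ, τ].Nodup)
    (hao : R.Avoids c a o) (hbo : R.Avoids c b o) (hbτ : R.Avoids c b τ)
    (huo : R.Avoids c u o) (huσ : R.Avoids c u σ) (huτ : R.Avoids c u τ)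
    (hxo : R.Avoids c x o) (hxβ : R.Avoids c x β) (hyo : R.Avoids c y o) (hyβ : R.Avoids c y β) :
    ∃ c' : Sym2 V → C, G.IsProperOn c' := by
  have hd' := hd
  simp only [List.nodup_cons, List.mem_cons, List.not_mem_nil, or_false, not_or] at hd' hcol
  -- The chain of `u` cannot contain both `x` and `y`. A swap outside it gives one of them `σ`, and
  -- the other leg takes `o`.
  have hS := R.isKempeClosed_kempeChain c σ β u
  have huS := R.mem_kempeChain_self c σ β u
  have hxy := hc.kempeChain_ends (p := u) (q := x) (r := y) (by tauto) (by tauto) (by tauto)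
    (.inl huσ) (.inr hxβ) (.inr hyβ)
  obtain ⟨c₁, hc₁, -, h₁⟩ := hc.exists_kempeSwap hS.compl
  generalize R.kempeChain c σ β u = S at *
  by_cases hxS : x ∈ S
  · refine hc₁.exists_of_fork hd hR (p := o) (q := τ) (r := o) (s := σ)
      ?_ ?_ ?_ ?_ ?_ ?_ ?_ ?_ ?_ ?_ ?_ ?_
    all_goals grind [kempeSwap]
  · refine hc₁.exists_of_fork hd hR (p := o) (q := τ) (r := σ) (s := o)
      ?_ ?_ ?_ ?_ ?_ ?_ ?_ ?_ ?_ ?_ ?_ ?_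
    all_goals grind [kempeSwap]

/-- A fork can be colored if the colors `o`, `β`, `τ` are missing at `a`, the colors `o`, `σ`, `τ`
at `u`, the colors `o`, `β` at `b` and `x`, and the colors `o`, `τ` at `y`. -/
theorem IsProperOn.exists_of_fork_of_missing_crossed (hc : R.IsProperOn c)
    (hd : [a, b, u, x, y].Nodup)
    (hR : ∀ v w, G.Adj v w → R.Adj v w ∨ s(v, w) = s(a, b) ∨ s(v, w) = s(b, u) ∨
      s(v, w) = s(u, x) ∨ s(v, w) = s(u, y))
    {o β σ τ : C} (hcol : [o, β, σ, τ].Nodup)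
    (hao : R.Avoids c a o) (haβ : R.Avoids c a β) (haτ : R.Avoids c a τ)
    (hbo : R.Avoids c b o) (hbβ : R.Avoids c b β)
    (huo : R.Avoids c u o) (huσ : R.Avoids c u σ) (huτ : R.Avoids c u τ)
    (hxo : R.Avoids c x o) (hxβ : R.Avoids c x β) (hyo : R.Avoids c y o) (hyτ : R.Avoids c y τ) :
    ∃ c' : Sym2 V → C, G.IsProperOn c' := by
  have hd' := hd
  have hcol' := hcol
  simp only [List.nodup_cons, List.mem_cons, List.not_mem_nil, or_false, not_or] at hd' hcol'
  -- `u` misses both `σ` and `o`, and `a` both `β` and `τ`, so swaps on `S` and `T` respectively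
  -- preserve these pairs.
  obtain ⟨S, hS, haS, hS'⟩ := hc.exists_isKempeClosed_pair (α := σ) (β := o) (p := a) (q := b)
    (r := x) (s := y) (by tauto) (by tauto) (by tauto) (by tauto) (by tauto) (by tauto)
    (.inr hao) (.inr hbo) (.inr hxo) (.inr hyo)
  obtain ⟨T, hT, hbT, hT'⟩ := hc.exists_isKempeClosed_pair (α := β) (β := τ) (p := b) (q := u)
    (r := x) (s := y) (by tauto) (by tauto) (by tauto) (by tauto) (by tauto) (by tauto)
    (.inl hbβ) (.inr huτ) (.inl hxβ) (.inr hyτ)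
  obtain ⟨c₁, hc₁, h, h₁⟩ := hc.exists_kempeSwap hS
  rcases hS' with hS' | hS' | hS'
  · refine hc₁.exists_of_fork hd hR (p := β) (q := σ) (r := o) (s := τ)
      ?_ ?_ ?_ ?_ ?_ ?_ ?_ ?_ ?_ ?_ ?_ ?_
    all_goals grind [kempeSwap]
  · refine hc₁.exists_of_fork hd hR (p := β) (q := o) (r := σ) (s := τ)
      ?_ ?_ ?_ ?_ ?_ ?_ ?_ ?_ ?_ ?_ ?_ ?_
    all_goals grind [kempeSwap]
  -- Here `y` has traded `o` for `σ`, while `b` and `x` have kept `o`. A swap on `T` then makes `τ`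
  -- available for `ab`.
  obtain ⟨c₂, hc₂, -, h₂⟩ := hc₁.exists_kempeSwap
    (hT.of_kempeSwap (by tauto) (by tauto) (by tauto) (by tauto) h)
  rcases hT' with hT' | hT' | hT'
  · refine hc₂.exists_of_fork hd hR (p := τ) (q := o) (r := β) (s := σ)
      ?_ ?_ ?_ ?_ ?_ ?_ ?_ ?_ ?_ ?_ ?_ ?_
    all_goals grind [kempeSwap]
  · refine hc₂.exists_of_fork hd hR (p := τ) (q := o) (r := τ) (s := σ)
      ?_ ?_ ?_ ?_ ?_ ?_ ?_ ?_ ?_ ?_ ?_ ?_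
    all_goals grind [kempeSwap]
  -- Swapping on `T` in the original coloring makes `x` and `y` miss the same pair `o`, `β`.
  · obtain ⟨c₃, hc₃, -, h₃⟩ := hc.exists_kempeSwap hT
    refine hc₃.exists_of_fork_of_missing_pair hd hR hcol ?_ ?_ ?_ ?_ ?_ ?_ ?_ ?_ ?_ ?_
    all_goals grind [kempeSwap]

/-- A fork can be colored if the colors `o`, `σ`, `τ` are missing at `a` and `u`, the colors `o`,
`β` at `b`, the colors `σ`, `o` at `x`, and the colors `τ`, `o` at `y`. -/
theorem IsProperOn.exists_of_fork_of_missing_eq (hc : R.IsProperOn c) (hd : [a, b, u, x, y].Nodup)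
    (hR : ∀ v w, G.Adj v w → R.Adj v w ∨ s(v, w) = s(a, b) ∨ s(v, w) = s(b, u) ∨
      s(v, w) = s(u, x) ∨ s(v, w) = s(u, y))
    {o β σ τ : C} (hcol : [o, β, σ, τ].Nodup)
    (hao : R.Avoids c a o) (haσ : R.Avoids c a σ) (haτ : R.Avoids c a τ)
    (hbo : R.Avoids c b o) (hbβ : R.Avoids c b β)
    (huo : R.Avoids c u o) (huσ : R.Avoids c u σ) (huτ : R.Avoids c u τ)
    (hxσ : R.Avoids c x σ) (hxo : R.Avoids c x o) (hyτ : R.Avoids c y τ) (hyo : R.Avoids c y o) :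
    ∃ c' : Sym2 V → C, G.IsProperOn c' := by
  have hd' := hd
  have hcol' := hcol
  simp only [List.nodup_cons, List.mem_cons, List.not_mem_nil, or_false, not_or] at hd' hcol'
  -- Either `β` can be freed at `u` for `bu`, or a swap outside the chain trades `σ` for `β` at `a`
  -- and `x`.
  have hS := R.isKempeClosed_kempeChain c σ β u
  have huS := R.mem_kempeChain_self c σ β u
  by_cases hbS : b ∈ R.kempeChain c σ β u
  · have haS := hc.kempeChain_ends (by tauto) (by tauto) (by tauto) (.inl huσ) (.inr hbβ)
      (r := a) (.inl haσ) hbS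
    have hxS := hc.kempeChain_ends (by tauto) (by tauto) (by tauto) (.inl huσ) (.inr hbβ)
      (r := x) (.inl hxσ) hbS
    obtain ⟨c₁, hc₁, -, h₁⟩ := hc.exists_kempeSwap hS.compl
    generalize R.kempeChain c σ β u = S at *
    refine hc₁.exists_of_fork_of_missing_crossed hd hR hcol ?_ ?_ ?_ ?_ ?_ ?_ ?_ ?_ ?_ ?_ ?_ ?_
    all_goals grind [kempeSwap]
  · obtain ⟨c₁, hc₁, -, h₁⟩ := hc.exists_kempeSwap hS
    generalize R.kempeChain c σ β u = S at *
    refine hc₁.exists_of_fork hd hR (p := o) (q := β) (r := o) (s := τ)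
      ?_ ?_ ?_ ?_ ?_ ?_ ?_ ?_ ?_ ?_ ?_ ?_
    all_goals grind [kempeSwap]

end Fork

/-! ### Kempe changes fixing the colors at `a` and `b` -/

section Config

variable {V C : Type*}

/-- A map that gives different colors to adjacent edges of `G - ab`, where `G` has no such map, with
the colors in `A` missing at `a`, the colors in `B` missing at `b`, and an edge `bu` of color
`o ∈ A`. -/
structure IsKempeConfig (G : SimpleGraph V) (a b u : V) (A B : Set C) (o : C)
    (c : Sym2 V → C) : Prop where
  not_exists : ¬ ∃ c' : Sym2 V → C, G.IsProperOn c'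
  adj : (G.deleteEdges {s(a, b)}).Adj b u
  ne : a ≠ b
  ne' : a ≠ u
  isProperOn : (G.deleteEdges {s(a, b)}).IsProperOn c
  avoids_left : ∀ γ ∈ A, (G.deleteEdges {s(a, b)}).Avoids c a γ
  avoids_right : ∀ γ ∈ B, (G.deleteEdges {s(a, b)}).Avoids c b γ
  color : c s(b, u) = o
  mem : o ∈ A

/-- An edge `uz` of `G - ab` of color `p` such that the color `δ` is missing at `z`. -/
structure IsLeg (G : SimpleGraph V) (a b u : V) (c : Sym2 V → C) (z : V) (p δ : C) : Prop where
  adj : (G.deleteEdges {s(a, b)}).Adj u z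
  ne : a ≠ z
  ne' : b ≠ z
  color : c s(u, z) = p
  avoids : (G.deleteEdges {s(a, b)}).Avoids c z δ

/-- Erasing an edge frees its color at its ends, since no other edge there has it. -/
theorem IsProperOn.avoids_of_not_adj {H R : SimpleGraph V} {c : Sym2 V → C} (hc : H.IsProperOn c)
    (hR : R ≤ H) {v w : V} {γ : C} (h : H.Adj v w) (hγ : c s(v, w) = γ) (h' : ¬ R.Adj v w) :
    R.Avoids c v γ := by
  rintro z hz rfl
  exact h' (hc (hR hz) h hγ.symm ▸ hz)

variable {G : SimpleGraph V} {a b u x y z : V} {A B : Set C} {o : C} {c : Sym2 V → C}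
  {p q α β γ δ ε σ τ : C}

theorem IsLeg.color_ne (hx : G.IsLeg a b u c x p δ) : p ≠ δ := by
  rintro rfl
  exact hx.avoids u hx.adj.symm (by rw [Sym2.eq_swap, hx.color])

namespace IsKempeConfig

theorem color_ne (hb : G.IsKempeConfig a b u A B o c) (hx : G.IsLeg a b u c x p δ) : o ≠ p := by
  intro h
  refine hx.ne' (hb.isProperOn hb.adj.symm hx.adj ?_)
  rw [Sym2.eq_swap, hb.color, hx.color, h]

theorem leg_color_ne (hb : G.IsKempeConfig a b u A B o c) (hx : G.IsLeg a b u c x p δ)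
    (hy : G.IsLeg a b u c y q ε) (hxy : x ≠ y) : p ≠ q := by
  intro h
  exact hxy (hb.isProperOn hx.adj hy.adj (by rw [hx.color, hy.color, h]))

/-- A common color could be given to `ab`. -/
theorem disjoint (hb : G.IsKempeConfig a b u A B o c) (hA : γ ∈ A) : γ ∉ B := by
  intro hB
  obtain ⟨c', hc', -⟩ := hb.isProperOn.exists_insert (H' := G) (p := a) (q := b)
    (fun v w h => by
      rw [deleteEdges_adj, Set.mem_singleton_iff]
      tauto) (hb.avoids_left γ hA) (hb.avoids_right γ hB)
  exact hb.not_exists ⟨c', hc'⟩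

theorem ne_of_mem (hb : G.IsKempeConfig a b u A B o c) (hα : α ∈ A) (hβ : β ∈ B) : α ≠ β :=
  fun h => hb.disjoint hα (h ▸ hβ)

/-- A Kempe change that does not affect `a` and `b`. -/
theorem exists_swap [Finite V] [DecidableEq C] (hb : G.IsKempeConfig a b u A B o c) (hα : α ∈ A)
    (hβ : β ∈ B) {v : V} (hav : a ≠ v) (hbv : b ≠ v)
    (hv : (G.deleteEdges {s(a, b)}).IsKempeEnd c α β v) :
    ∃ (c' : Sym2 V → C) (S : Set V), G.IsKempeConfig a b u A B o c' ∧ v ∈ S ∧ (o = α → u ∉ S) ∧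
      ∀ z p δ, G.IsLeg a b u c z p δ →
        G.IsLeg a b u c' z (kempeSwap α β S u p) (kempeSwap α β S z δ) ∧
        (p = α ∨ p = β → (u ∈ S ↔ z ∈ S)) := by
  set H := G.deleteEdges {s(a, b)}
  have hc := hb.isProperOn
  have haα := hb.avoids_left α hα
  have hbβ := hb.avoids_right β hβ
  have hne : α ≠ β := fun h => hb.disjoint hα (h ▸ hβ)
  -- Otherwise a swap on the chain of `a` makes `β` missing at both ends of `ab`.
  have hba : b ∈ H.kempeChain c α β a := by
    by_contra hba
    obtain ⟨c', hc', -, h⟩ := hc.exists_kempeSwap (H.isKempeClosed_kempeChain c α β a)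
    have haβ := h a α haα
    have hbβ := h b β hbβ
    simp only [kempeSwap, H.mem_kempeChain_self c α β a, hba, if_true, if_false,
      Equiv.swap_apply_left] at haβ hbβ
    obtain ⟨c'', hc'', -⟩ := hc'.exists_insert (H' := G) (p := a) (q := b)
      (fun v w h => by
        rw [deleteEdges_adj, Set.mem_singleton_iff]
        tauto) haβ hbβ
    exact hb.not_exists ⟨c'', hc''⟩
  -- `a` and `b` already are the two ends of their chain, so the chain of `v` avoids both.
  have hva : v ∉ H.kempeChain c α β a :=
    hc.kempeChain_ends hb.ne hav hbv (.inl haα) (.inr hbβ) hv hba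
  have haS : a ∉ H.kempeChain c α β v := fun h => hva (mem_kempeChain_comm.1 h)
  have hbS : b ∉ H.kempeChain c α β v := fun h => hva (hba.trans (mem_kempeChain_comm.1 h))
  have hS := H.isKempeClosed_kempeChain c α β v
  have hvS := H.mem_kempeChain_self c α β v
  obtain ⟨c', hc', h₁, h₂⟩ := hc.exists_kempeSwap hS
  generalize H.kempeChain c α β v = S at *
  refine ⟨c', S, ⟨hb.not_exists, hb.adj, hb.ne, hb.ne', hc', fun γ hγ => ?_, fun γ hγ => ?_, ?_,
    hb.mem⟩, hvS, fun ho huS => hbS ((hS hb.adj (.inl (hb.color.trans ho))).2 huS),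
    fun z p δ hz => ⟨⟨hz.adj, hz.ne, hz.ne', ?_, h₂ z δ hz.avoids⟩, fun hp => ?_⟩⟩
  · have := h₂ a γ (hb.avoids_left γ hγ)
    rwa [kempeSwap, if_neg haS] at this
  · have := h₂ b γ (hb.avoids_right γ hγ)
    rwa [kempeSwap, if_neg hbS] at this
  · rw [h₁ b u hb.adj, kempeSwap, if_neg hbS, hb.color]
  · rw [h₁ u z hz.adj, hz.color]
  · exact hS hz.adj (by rwa [hz.color])

/-- Otherwise `ab`, `bu`, `ux` can be recolored `o`, `p`, `o`. -/
theorem not_isLeg_base_color (hb : G.IsKempeConfig a b u A B o c) (hp : p ∈ B) :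
    ¬ G.IsLeg a b u c x p o := by
  intro hx
  have hc := hb.isProperOn
  have hle : G.deleteEdges {s(a, b), s(b, u), s(u, x)} ≤ G.deleteEdges {s(a, b)} :=
    deleteEdges_anti (by simp)
  have hbu := hb.adj.ne
  have hux := hx.adj.ne
  refine hb.not_exists ((hc.mono hle).exists_of_path (a := a) (b := b) (u := u) (x := x) ?_ ?_
    (hb.color_ne hx) (hb.color_ne hx).symm ((hb.avoids_left o hb.mem).mono hle)
    (hc.avoids_of_not_adj hle hb.adj hb.color (by simp)) ((hb.avoids_right p hp).mono hle)
    (hc.avoids_of_not_adj hle hx.adj hx.color (by simp))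
    (hc.avoids_of_not_adj hle hb.adj.symm (Sym2.eq_swap ▸ hb.color) (by simp [Sym2.eq_swap]))
    (hx.avoids.mono hle))
  · simp [hb.ne, hb.ne', hx.ne, hx.ne', hbu, hux]
  · intro v w h
    simp only [deleteEdges_adj, Set.mem_insert_iff, Set.mem_singleton_iff]
    tauto

section

variable [Finite V] [DecidableEq C]

/-- Erasing the fork frees `o` at `b` and `u`, `σ` at `u` and `x`, and `τ` at `u` and `y`, which
gives the hypotheses of the fork lemmas. -/
theorem false_of_legs (hb : G.IsKempeConfig a b u A B o c)
    (hx : G.IsLeg a b u c x σ δ) (hy : G.IsLeg a b u c y τ o) (hxy : x ≠ y) (hβ : β ∈ B)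
    (hσ : σ ∈ A) (hτ : τ ∈ A) (hδ : δ = β ∨ δ = o) : False := by
  have hc := hb.isProperOn
  have hle : G.deleteEdges {s(a, b), s(b, u), s(u, x), s(u, y)} ≤ G.deleteEdges {s(a, b)} :=
    deleteEdges_anti (by simp)
  have hd : [a, b, u, x, y].Nodup := by
    simp [hb.ne, hb.ne', hx.ne, hx.ne', hy.ne, hy.ne', hb.adj.ne, hx.adj.ne, hy.adj.ne, hxy]
  have hcol : [o, β, σ, τ].Nodup := by
    simp [hb.ne_of_mem hb.mem hβ, hb.color_ne hx, hb.color_ne hy, (hb.ne_of_mem hσ hβ).symm,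
      (hb.ne_of_mem hτ hβ).symm, hb.leg_color_ne hx hy hxy]
  have hR : ∀ v w, G.Adj v w → (G.deleteEdges {s(a, b), s(b, u), s(u, x), s(u, y)}).Adj v w ∨
      s(v, w) = s(a, b) ∨ s(v, w) = s(b, u) ∨ s(v, w) = s(u, x) ∨ s(v, w) = s(u, y) := by
    intro v w h
    simp only [deleteEdges_adj, Set.mem_insert_iff, Set.mem_singleton_iff]
    tauto
  have hc' := hc.mono hle
  have hao := (hb.avoids_left o hb.mem).mono hle
  have haσ := (hb.avoids_left σ hσ).mono hle
  have haτ := (hb.avoids_left τ hτ).mono hle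
  have hbo := hc.avoids_of_not_adj hle hb.adj hb.color (by simp)
  have hbβ := (hb.avoids_right β hβ).mono hle
  have huo := hc.avoids_of_not_adj hle hb.adj.symm (Sym2.eq_swap ▸ hb.color)
    (by simp [Sym2.eq_swap])
  have huσ := hc.avoids_of_not_adj hle hx.adj hx.color (by simp)
  have huτ := hc.avoids_of_not_adj hle hy.adj hy.color (by simp)
  have hxσ := hc.avoids_of_not_adj hle hx.adj.symm (Sym2.eq_swap ▸ hx.color)
    (by simp [Sym2.eq_swap])
  have hxδ := hx.avoids.mono hle
  have hyτ := hc.avoids_of_not_adj hle hy.adj.symm (Sym2.eq_swap ▸ hy.color)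
    (by simp [Sym2.eq_swap])
  have hyo := hy.avoids.mono hle
  refine hb.not_exists ?_
  rcases hδ with rfl | rfl
  · exact hc'.exists_of_fork_of_missing_ne hd hR hcol hao haσ haτ hbo hbβ huo huσ huτ hxσ hxδ hyτ hyo
  · exact hc'.exists_of_fork_of_missing_eq hd hR hcol hao haσ haτ hbo hbβ huo huσ huτ hxσ hxδ hyτ hyo

/-! ### One leg -/

/-- An `(o, δ)`-swap at `x` makes `o` missing there. Its chain avoids `u`, so `ux` keeps its color.
-/
theorem not_isLeg_right_right (hb : G.IsKempeConfig a b u A B o c) (hp : p ∈ B) (hδ : δ ∈ B) :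
    ¬ G.IsLeg a b u c x p δ := by
  intro hx
  obtain ⟨c', S, hb', hxS, huS, hleg⟩ := hb.exists_swap hb.mem hδ hx.ne hx.ne' (.inr hx.avoids)
  have h : G.IsLeg a b u c' x p o := by
    have := hleg x p δ hx
    grind [kempeSwap]
  exact hb'.not_isLeg_base_color hp h

theorem not_isLeg_right_left (hb : G.IsKempeConfig a b u A B o c) (hp : p ∈ B) (hδ : δ ∈ A)
    (hβ : β ∈ B) (hβp : β ≠ p) : ¬ G.IsLeg a b u c x p δ := by
  intro hx
  have hpδ := hx.color_ne
  obtain ⟨c', S, hb', hxS, -, hleg⟩ := hb.exists_swap hδ hβ hx.ne hx.ne' (.inl hx.avoids)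
  have h : G.IsLeg a b u c' x p β := by
    have := hleg x p δ hx
    grind [kempeSwap]
  exact hb'.not_isLeg_right_right hp hβ h

/-- The edge `ux` lies on the `(p, δ)`-chain of `x`, so a swap exchanges its color with the missing
one. -/
theorem not_isLeg_left_right (hb : G.IsKempeConfig a b u A B o c) (hp : p ∈ A) (hδ : δ ∈ B)
    (hβ : β ∈ B) (hβδ : β ≠ δ) : ¬ G.IsLeg a b u c x p δ := by
  intro hx
  obtain ⟨c', S, hb', hxS, -, hleg⟩ := hb.exists_swap hp hδ hx.ne hx.ne' (.inr hx.avoids)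
  have h : G.IsLeg a b u c' x δ p := by
    have := hleg x p δ hx
    grind [kempeSwap]
  exact hb'.not_isLeg_right_left hδ hp hβ hβδ h

/-- If two colors are available at `b`, then no color available at `a` or `b` is missing at the end
of a leg. -/
theorem not_isLeg_of_ne (hb : G.IsKempeConfig a b u A B o c) (hp : p ∈ A ∪ B) (hδ : δ ∈ A ∪ B)
    (hα : α ∈ B) (hβ : β ∈ B) (hαβ : α ≠ β) : ¬ G.IsLeg a b u c x p δ := by
  have key : ∀ γ : C, ∃ γ' ∈ B, γ' ≠ γ := fun γ => by
    by_cases h : α = γ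
    exacts [⟨β, hβ, h ▸ hαβ.symm⟩, ⟨α, hα, h⟩]
  rcases hp with hp | hp
  · rcases hδ with hδ | hδ
    · intro hx
      have hpδ := hx.color_ne
      have hpβ := hb.ne_of_mem hp hβ
      -- `p` differs from both swapped colors, so only the color missing at `x` moves into `B`.
      obtain ⟨c', S, hb', hxS, -, hleg⟩ := hb.exists_swap hδ hβ hx.ne hx.ne' (.inl hx.avoids)
      have h : G.IsLeg a b u c' x p β := by
        have := hleg x p δ hx
        grind [kempeSwap]
      exact hb'.not_isLeg_left_right hp hβ hα hαβ h
    · obtain ⟨γ, hγ, hne⟩ := key δ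
      exact hb.not_isLeg_left_right hp hδ hγ hne
  · rcases hδ with hδ | hδ
    · obtain ⟨γ, hγ, hne⟩ := key p
      exact hb.not_isLeg_right_left hp hδ hγ hne
    · exact hb.not_isLeg_right_right hp hδ

/-- A `(σ, β)`-swap at `x` recolors `ux` with `β` and leaves `o` missing at `x`. -/
theorem false_of_leg_base_color (hb : G.IsKempeConfig a b u A B o c) (hσ : σ ∈ A) (hβ : β ∈ B)
    (hx : G.IsLeg a b u c x σ β) (hx' : G.IsLeg a b u c x σ o) : False := by
  have h₁ := hb.color_ne hx
  have h₂ := hb.ne_of_mem hb.mem hβ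
  obtain ⟨c', S, hb', hxS, -, hleg⟩ := hb.exists_swap hσ hβ hx.ne hx.ne' (.inr hx.avoids)
  have h : G.IsLeg a b u c' x β o := by
    have := hleg x σ o hx'
    grind [kempeSwap]
  exact hb'.not_isLeg_base_color hβ h

theorem false_of_leg_right_left (hb : G.IsKempeConfig a b u A B o c) (hσ : σ ∈ A) (hβ : β ∈ B)
    (hδ : δ ∈ A) (hx : G.IsLeg a b u c x σ β) (hx' : G.IsLeg a b u c x σ δ) : False := by
  by_cases hδo : δ = o
  · subst hδo
    exact hb.false_of_leg_base_color hσ hβ hx hx'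
  have h₁ := hb.color_ne hx
  have h₂ := hb.ne_of_mem hb.mem hβ
  have h₃ := hb.ne_of_mem hδ hβ
  have h₄ := hb.ne_of_mem hσ hβ
  have h₅ := hx'.color_ne
  -- The missing pair `β`, `δ` becomes `o`, `δ` and then `o`, `β`, with `ux` still colored `σ`.
  obtain ⟨c₁, S, hb₁, hxS, huS, hleg⟩ := hb.exists_swap hb.mem hβ hx.ne hx.ne' (.inr hx.avoids)
  have hx₁ : G.IsLeg a b u c₁ x σ o := by
    have := hleg x σ β hx
    grind [kempeSwap]
  have hx₁' : G.IsLeg a b u c₁ x σ δ := by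
    have := hleg x σ δ hx'
    grind [kempeSwap]
  obtain ⟨c₂, T, hb₂, hxT, -, hleg⟩ := hb₁.exists_swap hδ hβ hx.ne hx.ne' (.inl hx₁'.avoids)
  have hx₂ : G.IsLeg a b u c₂ x σ o := by
    have := hleg x σ o hx₁
    grind [kempeSwap]
  have hx₂' : G.IsLeg a b u c₂ x σ β := by
    have := hleg x σ δ hx₁'
    grind [kempeSwap]
  exact hb₂.false_of_leg_base_color hσ hβ hx₂' hx₂

/-- At most one color available at `a` or `b` is missing at the end of a leg. -/
theorem leg_missing_unique (hb : G.IsKempeConfig a b u A B o c) (hβ : β ∈ B)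
    (hp : p ∈ A ∨ p = β) (hδ : δ ∈ A ∨ δ = β) (hε : ε ∈ A ∨ ε = β)
    (hx : G.IsLeg a b u c x p δ) (hx' : G.IsLeg a b u c x p ε) : δ = ε := by
  by_contra hne
  have h₁ := hx.color_ne
  have h₂ := hx'.color_ne
  rcases hδ with hδ | rfl
  · rcases hε with hε | rfl
    · have h₃ := hb.ne_of_mem hδ hβ
      have h₄ := hb.ne_of_mem hε hβ
      obtain ⟨c', S, hb', hxS, -, hleg⟩ := hb.exists_swap hδ hβ hx.ne hx.ne' (.inl hx.avoids)
      obtain ⟨σ, hσ, h, h'⟩ : ∃ σ ∈ A, G.IsLeg a b u c' x σ β ∧ G.IsLeg a b u c' x σ ε := by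
        have k := hleg x p δ hx
        have k' := hleg x p ε hx'
        rcases hp with hp | rfl
        · have h₅ := hb.ne_of_mem hp hβ
          exact ⟨p, hp, by grind [kempeSwap], by grind [kempeSwap]⟩
        -- The edge `ux` of color `β` lies on the swapped chain and receives `δ`.
        · exact ⟨δ, hδ, by grind [kempeSwap], by grind [kempeSwap]⟩
      exact hb'.false_of_leg_right_left hσ hβ hε h h'
    · exact hb.false_of_leg_right_left (by tauto) hβ hδ hx' hx
  · exact hb.false_of_leg_right_left (by tauto) hβ (by tauto) hx hx'

/-! ### Two legs -/

theorem false_of_legs_left_base (hb : G.IsKempeConfig a b u A B o c) (hβ : β ∈ B)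
    (hx : G.IsLeg a b u c x σ δ) (hy : G.IsLeg a b u c y τ o) (hxy : x ≠ y)
    (hσ : σ ∈ A) (hτ : τ ∈ A) (hδ : δ ∈ A ∨ δ = β) : False := by
  by_cases hδ' : δ = β ∨ δ = o
  · exact hb.false_of_legs hx hy hxy hβ hσ hτ hδ'
  rw [not_or] at hδ'
  have hδA := hδ.resolve_right hδ'.1
  have h₁ := hx.color_ne
  have h₂ := hb.ne_of_mem hσ hβ
  have h₃ := hb.ne_of_mem hb.mem hβ
  have h₄ := hb.ne_of_mem hτ hβ
  obtain ⟨c', S, hb', hxS, -, hleg⟩ := hb.exists_swap hδA hβ hx.ne hx.ne' (.inl hx.avoids)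
  have hx' : G.IsLeg a b u c' x σ β := by
    have := hleg x σ δ hx
    grind [kempeSwap]
  -- The color of `uy` changes only if `τ = δ` and `u ∈ S`.
  have hy' : G.IsLeg a b u c' y τ o ∨ G.IsLeg a b u c' y β o := by
    have := hleg y τ o hy
    grind [kempeSwap]
  rcases hy' with hy' | hy'
  · exact hb'.false_of_legs hx' hy' hxy hβ hσ hτ (.inl rfl)
  · exact hb'.not_isLeg_base_color hβ hy'

theorem false_of_legs_left_right (hb : G.IsKempeConfig a b u A B o c) (hβ : β ∈ B)
    (hx : G.IsLeg a b u c x σ δ) (hy : G.IsLeg a b u c y τ β) (hxy : x ≠ y)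
    (hσ : σ ∈ A) (hτ : τ ∈ A) (hδ : δ ∈ A ∨ δ = β) : False := by
  have ho := hb.mem
  obtain ⟨c', S, hb', hyS, huS, hleg⟩ := hb.exists_swap hb.mem hβ hy.ne hy.ne' (.inr hy.avoids)
  have hy' : G.IsLeg a b u c' y τ o := by
    have := hleg y τ β hy
    grind [kempeSwap]
  obtain ⟨δ', hδ', hx'⟩ : ∃ δ', (δ' ∈ A ∨ δ' = β) ∧ G.IsLeg a b u c' x σ δ' := by
    have := hleg x σ δ hx
    exact ⟨kempeSwap o β S x δ, by grind [kempeSwap], by grind [kempeSwap]⟩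
  exact hb'.false_of_legs_left_base hβ hx' hy' hxy hσ hτ hδ'

theorem false_of_legs_right_base (hb : G.IsKempeConfig a b u A B o c) (hβ : β ∈ B)
    (hx : G.IsLeg a b u c x β δ) (hy : G.IsLeg a b u c y τ o) (hxy : x ≠ y)
    (hτ : τ ∈ A) (hδ : δ ∈ A) : False := by
  by_cases hδo : δ = o
  · subst hδo
    exact hb.not_isLeg_base_color hβ hx
  have h₁ := hb.ne_of_mem hδ hβ
  have h₂ := hb.ne_of_mem hb.mem hβ
  have h₃ := hb.ne_of_mem hτ hβ
  obtain ⟨c', S, hb', hxS, -, hleg⟩ := hb.exists_swap hδ hβ hx.ne hx.ne' (.inl hx.avoids)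
  have hx' : G.IsLeg a b u c' x δ β := by
    have := hleg x β δ hx
    grind [kempeSwap]
  have hy' : G.IsLeg a b u c' y τ o ∨ G.IsLeg a b u c' y β o := by
    have := hleg y τ o hy
    grind [kempeSwap]
  rcases hy' with hy' | hy'
  · exact hb'.false_of_legs hx' hy' hxy hβ hδ hτ (.inl rfl)
  · exact hb'.not_isLeg_base_color hβ hy'

/-- An `(o, β)`-swap at `y` avoids `u`, hence also `x`, as `ux` has color `β`. So the leg at `x`
survives even if `δ = o`. -/
theorem false_of_legs_right_right (hb : G.IsKempeConfig a b u A B o c) (hβ : β ∈ B)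
    (hx : G.IsLeg a b u c x β δ) (hy : G.IsLeg a b u c y τ β) (hxy : x ≠ y)
    (hτ : τ ∈ A) (hδ : δ ∈ A) : False := by
  obtain ⟨c', S, hb', hyS, huS, hleg⟩ := hb.exists_swap hb.mem hβ hy.ne hy.ne' (.inr hy.avoids)
  have hy' : G.IsLeg a b u c' y τ o := by
    have := hleg y τ β hy
    grind [kempeSwap]
  have hx' : G.IsLeg a b u c' x β δ := by
    have := hleg x β δ hx
    grind [kempeSwap]
  exact hb'.false_of_legs_right_base hβ hx' hy' hxy hτ hδ

theorem false_of_legs_right_left (hb : G.IsKempeConfig a b u A B o c) (hβ : β ∈ B)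
    (hx : G.IsLeg a b u c x β δ) (hy : G.IsLeg a b u c y τ ε) (hxy : x ≠ y)
    (hτ : τ ∈ A) (hδ : δ ∈ A) (hε : ε ∈ A) : False := by
  have h₁ := hb.ne_of_mem hτ hβ
  have h₂ := hy.color_ne
  obtain ⟨c', S, hb', hyS, -, hleg⟩ := hb.exists_swap hε hβ hy.ne hy.ne' (.inl hy.avoids)
  have hy' : G.IsLeg a b u c' y τ β := by
    have := hleg y τ ε hy
    grind [kempeSwap]
  have hx' := hleg x β δ hx
  -- If `u ∈ S`, then `ux` becomes `ε`; otherwise `x ∉ S` too and its leg is unchanged.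
  by_cases huS : u ∈ S
  · refine hb'.false_of_legs_left_right hβ (σ := ε) (δ := kempeSwap ε β S x δ) ?_ hy' hxy hε hτ ?_
    all_goals grind [kempeSwap]
  · refine hb'.false_of_legs_right_right hβ (δ := δ) ?_ hy' hxy hτ hδ
    grind [kempeSwap]

theorem false_of_legs_left_left (hb : G.IsKempeConfig a b u A B o c) (hβ : β ∈ B)
    (hx : G.IsLeg a b u c x σ δ) (hy : G.IsLeg a b u c y τ ε) (hxy : x ≠ y)
    (hσ : σ ∈ A) (hτ : τ ∈ A) (hδ : δ ∈ A ∨ δ = β) (hε : ε ∈ A) : False := by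
  have h₁ := hb.ne_of_mem hτ hβ
  have h₂ := hy.color_ne
  have h₃ := hb.ne_of_mem hσ hβ
  obtain ⟨c', S, hb', hyS, -, hleg⟩ := hb.exists_swap hε hβ hy.ne hy.ne' (.inl hy.avoids)
  have hy' : G.IsLeg a b u c' y τ β := by
    have := hleg y τ ε hy
    grind [kempeSwap]
  obtain ⟨hx', -⟩ := hleg x σ δ hx
  have hδ' : kempeSwap ε β S x δ ∈ A ∨ kempeSwap ε β S x δ = β := by grind [kempeSwap]
  have hσ' : kempeSwap ε β S u σ = σ ∨ kempeSwap ε β S u σ = β := by grind [kempeSwap]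
  have hne := hx'.color_ne
  rcases hσ' with h | h <;> rw [h] at hx' hne
  · exact hb'.false_of_legs_left_right hβ hx' hy' hxy hσ hτ hδ'
  · exact hb'.false_of_legs_right_right hβ hx' hy' hxy hτ (hδ'.resolve_right hne.symm)

/-- There are no two legs such that at the end of each a color available at `a` or `b` is
missing. -/
theorem false_of_two_legs (hb : G.IsKempeConfig a b u A B o c) (hβ : β ∈ B)
    (hx : G.IsLeg a b u c x p δ) (hy : G.IsLeg a b u c y q ε) (hxy : x ≠ y)
    (hp : p ∈ A ∨ p = β) (hq : q ∈ A ∨ q = β) (hδ : δ ∈ A ∨ δ = β) (hε : ε ∈ A ∨ ε = β) :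
    False := by
  have hpq := hb.leg_color_ne hx hy hxy
  have hpδ := hx.color_ne
  have hqε := hy.color_ne
  rcases hp with hp | rfl
  · rcases hq with hq | rfl
    · rcases hε with hε | rfl
      · exact hb.false_of_legs_left_left hβ hx hy hxy hp hq hδ hε
      · exact hb.false_of_legs_left_right hβ hx hy hxy hp hq hδ
    · have hε' := hε.resolve_right hqε.symm
      rcases hδ with hδ | rfl
      · exact hb.false_of_legs_right_left hβ hy hx hxy.symm hp hε' hδ
      · exact hb.false_of_legs_right_right hβ hy hx hxy.symm hp hε'
  · have hq' := hq.resolve_right hpq.symm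
    have hδ' := hδ.resolve_right hpδ.symm
    rcases hε with hε | rfl
    · exact hb.false_of_legs_right_left hβ hx hy hxy hq' hδ' hε
    · exact hb.false_of_legs_right_right hβ hx hy hxy hq' hδ'

end

end IsKempeConfig

end Config

/-! ### Translation from edge colorings and Kierstead paths -/

section EdgeColoring

variable {V : Type*}

open Classical in
/-- An edge coloring as a map on all pairs of vertices. -/
noncomputable def EdgeColoring.extend {H : SimpleGraph V} {k : ℕ} (φ : H.EdgeColoring k)
    (d : Fin k) (e : Sym2 V) : Fin k :=
  if h : e ∈ H.edgeSet then φ ⟨e, h⟩ else d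

namespace EdgeColoring

variable {H : SimpleGraph V} {k : ℕ} (φ : H.EdgeColoring k) (d : Fin k)

theorem extend_of_mem {e : Sym2 V} (h : e ∈ H.edgeSet) : φ.extend d e = φ ⟨e, h⟩ :=
  dif_pos h

theorem isProperOn_extend : H.IsProperOn (φ.extend d) := by
  intro v w w' h h' e
  by_contra hne
  rw [φ.extend_of_mem d (e := s(v, w)) h, φ.extend_of_mem d (e := s(v, w')) h'] at e
  refine φ.valid ?_ e
  rw [lineGraph_adj_iff_exists]
  refine ⟨fun heq => hne ?_, v, by simp, by simp⟩
  exact Sym2.congr_right.1 (congrArg Subtype.val heq)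

theorem avoids_extend_iff {v : V} {γ : Fin k} : H.Avoids (φ.extend d) v γ ↔ γ ∈ φ.missing v := by
  simp only [missing, present, Finset.mem_sdiff, Finset.mem_univ, Finset.mem_filter, true_and,
    not_exists, not_and]
  constructor
  · rintro h ⟨e, he⟩ hv rfl
    obtain ⟨w, rfl⟩ := Sym2.mem_iff_exists.1 hv
    exact h w he (φ.extend_of_mem d he)
  · intro h w hw
    rw [φ.extend_of_mem d (e := s(v, w)) hw]
    exact h ⟨s(v, w), hw⟩ (by simp)

end EdgeColoring

theorem IsProperOn.colorable_lineGraph {G : SimpleGraph V} {k : ℕ} {c : Sym2 V → Fin k}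
    (hc : G.IsProperOn c) : G.lineGraph.Colorable k := by
  refine ⟨Coloring.mk (fun e => c e) ?_⟩
  rintro ⟨e, he⟩ ⟨e', he'⟩ h
  rw [lineGraph_adj_iff_exists] at h
  obtain ⟨hne, v, hv, hv'⟩ := h
  obtain ⟨w, rfl⟩ := Sym2.mem_iff_exists.1 hv
  obtain ⟨w', rfl⟩ := Sym2.mem_iff_exists.1 hv'
  intro heq
  have := hc he he' heq
  subst this
  exact hne rfl

theorem degree_le_of_isProperOn [Fintype V] {G : SimpleGraph V} [DecidableRel G.Adj] {k : ℕ}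
    {c : Sym2 V → Fin k} (hc : G.IsProperOn c) (v : V) : G.degree v ≤ k := by
  rw [← card_neighborFinset_eq_degree]
  refine (Finset.card_le_card_of_injOn (t := Finset.univ) (fun w => c s(v, w)) (by simp) ?_).trans
    (by simp)
  intro w hw w' hw' h
  exact hc ((G.mem_neighborFinset v w).1 hw) ((G.mem_neighborFinset v w').1 hw') h

theorem maxDegree_le_chromaticIndex [Fintype V] (G : SimpleGraph V) [DecidableRel G.Adj] :
    (G.maxDegree : ℕ∞) ≤ G.chromaticIndex := by
  refine le_chromaticNumber_iff_colorable.2 fun k ⟨φ⟩ => G.maxDegree_le_of_forall_degree_le k ?_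
  intro v
  by_cases hk : G.degree v = 0
  · omega
  obtain ⟨w, hw⟩ := (G.degree_pos_iff_exists_adj v).1 (Nat.pos_of_ne_zero hk)
  exact degree_le_of_isProperOn (EdgeColoring.isProperOn_extend φ (φ ⟨s(v, w), hw⟩)) v

theorem IsClassTwo.not_exists_isProperOn [Fintype V] {G : SimpleGraph V} [DecidableRel G.Adj]
    (hG : G.IsClassTwo) : ¬ ∃ c : Sym2 V → Fin G.maxDegree, G.IsProperOn c := by
  rintro ⟨c, hc⟩
  exact hG (le_antisymm hc.colorable_lineGraph.chromaticNumber_le G.maxDegree_le_chromaticIndex)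

/-- At an end of a deleted edge some of `Δ` colors is missing. -/
theorem exists_avoids_deleteEdges [Fintype V] {G : SimpleGraph V} [DecidableRel G.Adj] {a b : V}
    (hab : G.Adj a b) {c : Sym2 V → Fin G.maxDegree} :
    ∃ γ, (G.deleteEdges {s(a, b)}).Avoids c b γ := by
  classical
  by_contra! h
  simp only [Avoids, not_forall, not_not] at h
  choose f hf hc using h
  have hinj : Function.Injective f := fun γ γ' e => by rw [← hc γ, ← hc γ', e]
  -- If every color were present at `b`, its at most `Δ - 1` remaining edges would carry `Δ` colors.
  have hle : (Finset.univ.image f).card ≤ ((G.neighborFinset b).erase a).card := by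
    refine Finset.card_le_card fun w hw => ?_
    obtain ⟨γ, -, rfl⟩ := Finset.mem_image.1 hw
    have := hf γ
    rw [deleteEdges_adj, Set.mem_singleton_iff] at this
    rw [Finset.mem_erase, mem_neighborFinset]
    refine ⟨fun e => this.2 ?_, this.1⟩
    rw [e, Sym2.eq_swap]
  rw [Finset.card_image_of_injective _ hinj, Finset.card_univ, Fintype.card_fin,
    Finset.card_erase_of_mem ((G.mem_neighborFinset b a).2 hab.symm),
    card_neighborFinset_eq_degree] at hle
  have h₁ := G.degree_le_maxDegree b
  have h₂ : 0 < G.degree b := (G.degree_pos_iff_exists_adj b).2 ⟨a, hab.symm⟩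
  omega

theorem EdgeColoring.notMem_missing {H : SimpleGraph V} {k : ℕ} (φ : H.EdgeColoring k) {v : V}
    {e : Sym2 V} (he : e ∈ H.edgeSet) (hv : v ∈ e) : φ ⟨e, he⟩ ∉ φ.missing v := by
  simp only [missing, present, Finset.mem_sdiff, Finset.mem_univ, Finset.mem_filter, true_and,
    not_not]
  exact ⟨⟨e, he⟩, hv, rfl⟩

/-- The edges and colors of a Kierstead path on four vertices. -/
theorem IsKiersteadPath.four {G : SimpleGraph V} {k : ℕ} {a b u x : V}
    {φ : (G.deleteEdges {s(a, b)}).EdgeColoring k}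
    (hK : G.IsKiersteadPath s(a, b) φ ![a, b, u, x]) :
    [a, b, u, x].Nodup ∧ G.Adj a b ∧ ∃ (hbu : s(b, u) ∈ (G.deleteEdges {s(a, b)}).edgeSet)
      (hux : s(u, x) ∈ (G.deleteEdges {s(a, b)}).edgeSet), φ ⟨s(b, u), hbu⟩ ∈ φ.missing a ∧
      (φ ⟨s(u, x), hux⟩ ∈ φ.missing a ∨ φ ⟨s(u, x), hux⟩ ∈ φ.missing b) := by
  have hinj := hK.injective
  have h₀₁ := hinj.ne (show (0 : Fin 4) ≠ 1 by decide)
  have h₀₂ := hinj.ne (show (0 : Fin 4) ≠ 2 by decide)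
  have h₀₃ := hinj.ne (show (0 : Fin 4) ≠ 3 by decide)
  have h₁₂ := hinj.ne (show (1 : Fin 4) ≠ 2 by decide)
  have h₁₃ := hinj.ne (show (1 : Fin 4) ≠ 3 by decide)
  have h₂₃ := hinj.ne (show (2 : Fin 4) ≠ 3 by decide)
  simp only [Matrix.cons_val] at h₀₁ h₀₂ h₀₃ h₁₂ h₁₃ h₂₃
  obtain ⟨hbu, i, hi, hmi⟩ := hK.color 1 (by decide)
  obtain ⟨hux, j, hj, hmj⟩ := hK.color 2 (by decide)
  refine ⟨by simp [*], hK.adj 0, hbu, hux, ?_, ?_⟩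
  -- The color of `bu` is present at `b`, so it can only be missing at `a`.
  · fin_cases i
    · exact hmi
    · exact absurd hmi (φ.notMem_missing _ (by simp))
    · exact absurd hi (by decide)
    · exact absurd hi (by decide)
  · fin_cases j
    · exact .inl hmj
    · exact .inr hmj
    · exact absurd hmj (φ.notMem_missing _ (by simp))
    · exact absurd hj (by decide)

end EdgeColoring

end SimpleGraph

theorem lemma3p1 {V : Type*} [Fintype V] (G : SimpleGraph V) [DecidableRel G.Adj]
    (hG : G.IsClassTwo) (a b u x y : V) (hxy : x ≠ y)
    (φ : (G.deleteEdges {s(a, b)}).EdgeColoring G.maxDegree)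
    (hK : G.IsKiersteadPath s(a, b) φ ![a, b, u, x])
    (hK' : G.IsKiersteadPath s(a, b) φ ![a, b, u, y]) :
    (φ.missing x ∩ (φ.missing a ∪ φ.missing b)).card +
      (φ.missing y ∩ (φ.missing a ∪ φ.missing b)).card ≤ 1 := by
  obtain ⟨hd, hab, hbu, hux, ho, hp⟩ := hK.four
  obtain ⟨hd', -, -, huy, -, hq⟩ := hK'.four
  simp only [List.nodup_cons, List.mem_cons, List.not_mem_nil, or_false, not_or] at hd hd'
  set o := φ ⟨s(b, u), hbu⟩
  set p := φ ⟨s(u, x), hux⟩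
  set q := φ ⟨s(u, y), huy⟩
  let A : Set (Fin G.maxDegree) := φ.missing a
  let B : Set (Fin G.maxDegree) := φ.missing b
  -- The default color `o` is immaterial: only values on edges of `G - ab` are used.
  have hb : G.IsKempeConfig a b u A B o (φ.extend o) :=
    { not_exists := hG.not_exists_isProperOn
      adj := hbu
      ne := hd.1.1
      ne' := hd.1.2.1
      isProperOn := φ.isProperOn_extend o
      avoids_left := fun γ hγ => (φ.avoids_extend_iff o).2 hγ
      avoids_right := fun γ hγ => (φ.avoids_extend_iff o).2 hγ
      color := φ.extend_of_mem o hbu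
      mem := ho }
  have hx : ∀ δ ∈ φ.missing x, G.IsLeg a b u (φ.extend o) x p δ := fun δ hδ =>
    ⟨hux, hd.1.2.2, hd.2.1.2, φ.extend_of_mem o hux, (φ.avoids_extend_iff o).2 hδ⟩
  have hy : ∀ δ ∈ φ.missing y, G.IsLeg a b u (φ.extend o) y q δ := fun δ hδ =>
    ⟨huy, hd'.1.2.2, hd'.2.1.2, φ.extend_of_mem o huy, (φ.avoids_extend_iff o).2 hδ⟩
  obtain ⟨β, hβ⟩ := SimpleGraph.exists_avoids_deleteEdges hab (c := φ.extend o)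
  replace hβ : β ∈ B := (φ.avoids_extend_iff o).1 hβ
  by_cases hB : ∃ β' ∈ B, β' ≠ β
  · obtain ⟨β', hβ', hne⟩ := hB
    have key : ∀ z r, (∀ δ ∈ φ.missing z, G.IsLeg a b u (φ.extend o) z r δ) → r ∈ A ∪ B →
        φ.missing z ∩ (φ.missing a ∪ φ.missing b) = ∅ := by
      intro z r hz hr
      refine Finset.eq_empty_of_forall_notMem fun δ hδ => ?_
      rw [Finset.mem_inter, Finset.mem_union] at hδ
      exact hb.not_isLeg_of_ne hr hδ.2 hβ' hβ hne (hz δ hδ.1)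
    rw [key x p hx hp, key y q hy hq]
    simp
  · push Not at hB
    have hB' : ∀ γ, (γ ∈ φ.missing a ∨ γ ∈ φ.missing b) → γ ∈ A ∨ γ = β :=
      fun γ => Or.imp_right (hB γ)
    have key : ∀ z r, (∀ δ ∈ φ.missing z, G.IsLeg a b u (φ.extend o) z r δ) → (r ∈ A ∨ r = β) →
        (φ.missing z ∩ (φ.missing a ∪ φ.missing b)).card ≤ 1 := by
      intro z r hz hr
      refine Finset.card_le_one.2 fun δ hδ ε hε => ?_
      rw [Finset.mem_inter, Finset.mem_union] at hδ hε
      exact hb.leg_missing_unique hβ hr (hB' δ hδ.2) (hB' ε hε.2) (hz δ hδ.1) (hz ε hε.1)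
    have h₁ := key x p hx (hB' p hp)
    have h₂ := key y q hy (hB' q hq)
    -- Each cardinality is at most `1`, so a sum above `1` makes both intersections nonempty.
    by_contra! h
    obtain ⟨δ, hδ⟩ := Finset.card_pos.1
      (show 0 < (φ.missing x ∩ (φ.missing a ∪ φ.missing b)).card by omega)
    obtain ⟨ε, hε⟩ := Finset.card_pos.1
      (show 0 < (φ.missing y ∩ (φ.missing a ∪ φ.missing b)).card by omega)
    rw [Finset.mem_inter, Finset.mem_union] at hδ hε
    exact hb.false_of_two_legs hβ (hx δ hδ.1) (hy ε hε.1) hxy (hB' p hp) (hB' q hq)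
      (hB' δ hδ.2) (hB' ε hε.2)
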